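/- Let $F$ be a field with algebraic closure $\overline{F}$, let $r,s$ be non-negative integers, and let $A\in F^{r\times r}$ and $B\in F^{s\times s}$. Let $C(A,B)=\{X\in F^{r\times s}\mid AX=XB\}$, a subspace of $F^{r\times s}$, and let $\dim$ denote dimension over $F$. For $\alpha\in\overline{F}$ let $k_{A,\alpha}=\dim_{\overline F}\ker(A-\alpha I)$ and $m_{A,\alpha}=\dim_{\overline F}\bigcup_{n\ge 0}\ker\big((A-\alpha I)^n\big)$ be the dimensions of the $\alpha$-eigenspace and of the generalized $\alpha$-eigenspace of $A$ acting on $\overline{F}^{\,r}$, and define $k_{B,\alpha}$, $m_{B,\alpha}$ in the same way for $B$ acting on $\overline{F}^{\,s}$. Then the two sums over $\alpha\in\overline{F}$ below have only finitely many non-zero terms, and (a) $\displaystyle\sum_{\alpha\in\overline{F}} k_{A,\alpha}k_{B,\alpha}\;\le\;\dim C(A,B)\;\le\;\sum_{\alpha\in\overline{F}} m_{A,\alpha}m_{B,\alpha}$; (b) $(r-\operatorname{rk}A)(s-\operatorname{rk}B)\;\le\;\dim C(A,B)\;\le\;(r-\operatorname{rk}A)(s-\operatorname{rk}B)+\operatorname{rk}A\cdot\operatorname{rk}B$.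 -/

import Mathlib

/-- The intertwining code `C(A,B)`: the `F`-subspace of all `r × s` matrices `X` over `F` with
`A X = X B`. -/
def intertwiningCode {F : Type*} [Field F] {r s : ℕ}
    (A : Matrix (Fin r) (Fin r) F) (B : Matrix (Fin s) (Fin s) F) :
    Submodule F (Matrix (Fin r) (Fin s) F) where
  carrier := {X | A * X = X * B}
  add_mem' := by
    intro X Y hX hY
    simp only [Set.mem_setOf_eq] at hX hY ⊢
    rw [Matrix.mul_add, Matrix.add_mul, hX, hY]
  zero_mem' := by simp
  smul_mem' := by
    intro c X hX
    simp only [Set.mem_setOf_eq] at hX ⊢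
    rw [Matrix.mul_smul, Matrix.smul_mul, hX]

/-- A square matrix `A` over `F` viewed as an endomorphism of the `r`-dimensional vector space
over the algebraic closure of `F`. -/
noncomputable def closureEnd {F : Type*} [Field F] {r : ℕ} (A : Matrix (Fin r) (Fin r) F) :
    Module.End (AlgebraicClosure F) (Fin r → AlgebraicClosure F) :=
  Matrix.toLin' (A.map (algebraMap F (AlgebraicClosure F)))

/-- `k_{A,α}`: the dimension of the `α`-eigenspace of `A` over the algebraic closure
(zero if `α` is not an eigenvalue). -/
noncomputable def eigDim {F : Type*} [Field F] {r : ℕ} (A : Matrix (Fin r) (Fin r) F)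
    (α : AlgebraicClosure F) : ℕ :=
  Module.finrank (AlgebraicClosure F) ((closureEnd A).eigenspace α)

/-- `m_{A,α}`: the dimension of the generalized `α`-eigenspace of `A` over the algebraic closure,
that is, of the space of all `v` with `(A - α I)^n v = 0` for some `n`
(zero if `α` is not an eigenvalue). -/
noncomputable def genEigDim {F : Type*} [Field F] {r : ℕ} (A : Matrix (Fin r) (Fin r) F)
    (α : AlgebraicClosure F) : ℕ :=
  Module.finrank (AlgebraicClosure F) ((closureEnd A).maxGenEigenspace α)

/-! View `C(A,B)` as the space of maps X with fX = Xg. The lower bounds come from the X that vanish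
on range g and land in ker f: they form a copy of Hom(coker g, ker f), of dimension dim ker f · dim
ker g. Replacing f, g by f - α, g - α leaves the intertwining condition unchanged, and the resulting
subspaces are independent as α varies. The upper bounds come from restricting X: to range g → range
f, or to the generalized eigenspaces, which span over the algebraic closure. Passing to the closure
is harmless, since `C(A,B)` is the kernel of X ↦ AX - XB and nullity survives field extension. -/

open Module in
/-- The linear maps `X : W → V` with `f ∘ X = X ∘ g`. -/
def intertwiners {K V W : Type*} [Field K] [AddCommGroup V] [Module K V] [AddCommGroup W]
    [Module K W] (f : End K V) (g : End K W) : Submodule K (W →ₗ[K] V) :=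
  LinearMap.eqLocus (LinearMap.llcomp K W V V f) (LinearMap.lcomp K V g)

open Module in
/-- The linear maps `X : W → V` with `f ∘ X = 0` and `X ∘ g = 0`. -/
def annihilated {K V W : Type*} [Field K] [AddCommGroup V] [Module K V] [AddCommGroup W]
    [Module K W] (f : End K V) (g : End K W) : Submodule K (W →ₗ[K] V) :=
  LinearMap.ker (LinearMap.llcomp K W V V f) ⊓ LinearMap.ker (LinearMap.lcomp K V g)

namespace intertwiners

open Module

variable {K V W : Type*} [Field K] [AddCommGroup V] [Module K V] [AddCommGroup W] [Module K W]

theorem mem_iff {f : End K V} {g : End K W} {X : W →ₗ[K] V} :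
    X ∈ intertwiners f g ↔ ∀ w, f (X w) = X (g w) := by
  simp [intertwiners, LinearMap.ext_iff]

theorem mem_annihilated_iff {f : End K V} {g : End K W} {X : W →ₗ[K] V} :
    X ∈ annihilated f g ↔ (∀ w, f (X w) = 0) ∧ ∀ w, X (g w) = 0 := by
  simp [annihilated, LinearMap.ext_iff]

theorem annihilated_le (f : End K V) (g : End K W) : annihilated f g ≤ intertwiners f g := by
  intro X hX
  rw [mem_annihilated_iff] at hX
  exact mem_iff.2 fun w ↦ by rw [hX.1, hX.2]

theorem annihilated_sub_le (f : End K V) (g : End K W) (α : K) :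
    annihilated (f - α • 1) (g - α • 1) ≤
      intertwiners f g := by
  intro X hX
  rw [mem_annihilated_iff] at hX
  refine mem_iff.2 fun w ↦ ?_
  have h1 := hX.1 w
  have h2 := hX.2 w
  simp only [LinearMap.sub_apply, LinearMap.smul_apply, Module.End.one_apply, map_sub, map_smul] at h1 h2
  rw [sub_eq_zero.1 h1, sub_eq_zero.1 h2]

variable [FiniteDimensional K V] [FiniteDimensional K W]

/-- Such X factor uniquely through coker g and ker f; for an endomorphism g, coker g and ker g have
equal dimension. -/
theorem finrank_annihilated (f : End K V) (g : End K W) :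
    finrank K (annihilated f g) =
      finrank K (LinearMap.ker f) * finrank K (LinearMap.ker g) := by
  let Φ : ((W ⧸ LinearMap.range g) →ₗ[K] LinearMap.ker f) →ₗ[K] (W →ₗ[K] V) :=
    LinearMap.lcomp K V (LinearMap.range g).mkQ ∘ₗ
      LinearMap.llcomp K _ _ _ (LinearMap.ker f).subtype
  have hΦ (Y w) : Φ Y w = Y ((LinearMap.range g).mkQ w) := rfl
  have hinj : Function.Injective Φ := by
    intro Y Z h
    ext w
    exact LinearMap.congr_fun h w
  have hrange : LinearMap.range Φ = annihilated f g := by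
    ext X
    rw [mem_annihilated_iff]
    constructor
    · rintro ⟨Y, rfl⟩
      refine ⟨fun w ↦ (Y _).2, fun w ↦ ?_⟩
      have h : (LinearMap.range g).mkQ (g w) = 0 :=
        (Submodule.Quotient.mk_eq_zero _).2 (LinearMap.mem_range_self g w)
      rw [hΦ, h]
      simp
    · rintro ⟨h1, h2⟩
      refine ⟨(LinearMap.range g).liftQ (X.codRestrict (LinearMap.ker f) h1) ?_, ?_⟩
      · rintro _ ⟨w, rfl⟩
        exact Subtype.ext (h2 w)
      · ext w
        rfl
  have hq := (LinearMap.range g).finrank_quotient_add_finrank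
  have hr := g.finrank_range_add_finrank_ker
  rw [← hrange, LinearMap.finrank_range_of_inj hinj, Module.finrank_linearMap, mul_comm]
  congr 1
  omega

theorem finrank_ker_mul_le (f : End K V) (g : End K W) :
    finrank K (LinearMap.ker f) * finrank K (LinearMap.ker g) ≤
      finrank K (intertwiners f g) := by
  rw [← finrank_annihilated]
  exact Submodule.finrank_mono (annihilated_le f g)

theorem finrank_le_ker_add_range (f : End K V) (g : End K W) :
    finrank K (intertwiners f g) ≤
      finrank K (LinearMap.ker f) * finrank K (LinearMap.ker g) +
        finrank K (LinearMap.range f) * finrank K (LinearMap.range g) := by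
  have hmaps (X : intertwiners f g) (w : LinearMap.range g) :
      X.1 w ∈ LinearMap.range f := by
    obtain ⟨_, w, rfl⟩ := w
    exact ⟨X.1 w, mem_iff.1 X.2 w⟩
  let φ : intertwiners f g →ₗ[K] (LinearMap.range g →ₗ[K] LinearMap.range f) :=
    { toFun X := (X.1 ∘ₗ (LinearMap.range g).subtype).codRestrict _ (hmaps X)
      map_add' _ _ := rfl
      map_smul' _ _ := rfl }
  -- If X kills range g, then fX = Xg = 0 as well.
  have hker : (LinearMap.ker φ).map (intertwiners f g).subtype ≤ annihilated f g := by
    rintro _ ⟨X, hX, rfl⟩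
    have h (w) : X.1 (g w) = 0 :=
      congrArg Subtype.val (LinearMap.congr_fun hX ⟨g w, LinearMap.mem_range_self g w⟩)
    exact mem_annihilated_iff.2 ⟨fun w ↦ (mem_iff.1 X.2 w).trans (h w), h⟩
  have h1 := Submodule.finrank_mono hker
  rw [Submodule.finrank_map_subtype_eq, finrank_annihilated] at h1
  have h2 := (LinearMap.range φ).finrank_le
  rw [Module.finrank_linearMap, mul_comm] at h2
  have h3 := φ.finrank_range_add_finrank_ker
  omega

theorem sum_finrank_le_of_iSupIndep {ι : Type*} {p : ι → Submodule K V} (hp : iSupIndep p)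
    (q : Submodule K V) (hq : ∀ i, p i ≤ q) (s : Finset ι) :
    ∑ i ∈ s, finrank K (p i) ≤ finrank K q := by
  classical
  have hs : iSupIndep fun i : s ↦ p i := hp.comp Subtype.val_injective
  have hrange : LinearMap.range (DFinsupp.lsum ℕ fun i : s ↦ (p i).subtype) ≤ q := by
    rw [← Submodule.iSup_eq_range_dfinsupp_lsum]
    exact iSup_le fun i ↦ hq i
  have h := Submodule.finrank_mono hrange
  rw [LinearMap.finrank_range_of_inj hs.dfinsupp_lsum_injective] at h
  rw [← Finset.sum_coe_sort, ← Module.finrank_directSum]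
  exact h

theorem sum_finrank_eigenspace_mul_le (f : End K V) (g : End K W) (s : Finset K) :
    ∑ α ∈ s, finrank K (f.eigenspace α) * finrank K (g.eigenspace α) ≤
      finrank K (intertwiners f g) := by
  have hind : iSupIndep fun α : K ↦
      annihilated (f - α • 1) (g - α • 1) := by
    -- (f - α)X = 0 makes X an α-eigenvector of left composition with f.
    refine (Module.End.eigenspaces_iSupIndep (LinearMap.llcomp K W V V f)).mono fun α X hX ↦ ?_
    rw [mem_annihilated_iff] at hX
    rw [Module.End.mem_eigenspace_iff]
    ext w
    simpa [sub_eq_zero] using hX.1 w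
  refine le_trans (Finset.sum_le_sum fun α _ ↦ ?_)
    (sum_finrank_le_of_iSupIndep hind _ (annihilated_sub_le f g) s)
  rw [finrank_annihilated, Module.End.eigenspace_def, Module.End.eigenspace_def]

omit [FiniteDimensional K V] [FiniteDimensional K W] in
theorem mapsTo_maxGenEigenspace {f : End K V} {g : End K W} {X : W →ₗ[K] V}
    (hX : X ∈ intertwiners f g) (α : K) {w : W} (hw : w ∈ g.maxGenEigenspace α) :
    X w ∈ f.maxGenEigenspace α := by
  rw [Module.End.mem_maxGenEigenspace] at hw ⊢
  obtain ⟨n, hn⟩ := hw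
  have h (n : ℕ) (w : W) : ((f - α • 1) ^ n) (X w) = X (((g - α • 1) ^ n) w) := by
    induction n generalizing w with
    | zero => simp
    | succ n ih =>
      rw [pow_succ, pow_succ, Module.End.mul_apply, Module.End.mul_apply, ← ih]
      simp [mem_iff.1 hX w]
  exact ⟨n, by rw [h, hn, map_zero]⟩

theorem finrank_le_sum_maxGenEigenspace (f : End K V) (g : End K W) (s : Finset K)
    (hs : ⨆ α ∈ s, g.maxGenEigenspace α = ⊤) :
    finrank K (intertwiners f g) ≤
      ∑ α ∈ s, finrank K (f.maxGenEigenspace α) * finrank K (g.maxGenEigenspace α) := by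
  let φ : intertwiners f g →ₗ[K]
      ((α : s) → (g.maxGenEigenspace α.1 →ₗ[K] f.maxGenEigenspace α.1)) :=
    { toFun X α := (X.1 ∘ₗ (g.maxGenEigenspace α.1).subtype).codRestrict _
        fun w ↦ mapsTo_maxGenEigenspace X.2 α.1 w.2
      map_add' _ _ := rfl
      map_smul' _ _ := rfl }
  have hinj : Function.Injective φ := by
    intro X Y h
    -- The locus where X and Y agree is a subspace, so it suffices that it contains a spanning
    -- family.
    have hle : ⨆ α ∈ s, g.maxGenEigenspace α ≤ LinearMap.eqLocus X.1 Y.1 :=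
      iSup₂_le fun α hα w hw ↦
        congrArg Subtype.val (LinearMap.congr_fun (congrFun h ⟨α, hα⟩) ⟨w, hw⟩)
    rw [hs] at hle
    exact Subtype.ext (LinearMap.ext fun w ↦ hle (x := w) trivial)
  have h := LinearMap.finrank_le_finrank_of_injective hinj
  rw [Module.finrank_pi_fintype] at h
  rw [← Finset.sum_coe_sort]
  simpa only [Module.finrank_linearMap, mul_comm] using h

end intertwiners

namespace Module.End

variable {K V : Type*} [Field K] [AddCommGroup V] [Module K V]

theorem hasEigenvalue_of_maxGenEigenspace_ne_bot {f : End K V} {α : K}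
    (h : f.maxGenEigenspace α ≠ ⊥) : f.HasEigenvalue α :=
  HasUnifEigenvalue.lt zero_lt_one (show f.HasUnifEigenvalue α ⊤ from h)

theorem finite_maxGenEigenspace_ne_bot [FiniteDimensional K V] (f : End K V) :
    {α : K | f.maxGenEigenspace α ≠ ⊥}.Finite :=
  (finite_hasEigenvalue f).subset fun _ h ↦ hasEigenvalue_of_maxGenEigenspace_ne_bot h

end Module.End

open Module TensorProduct in
theorem LinearMap.finrank_ker_baseChange {F : Type*} (K : Type*) {M N : Type*} [Field F] [Field K]
    [Algebra F K] [AddCommGroup M] [Module F M] [AddCommGroup N] [Module F N] (f : M →ₗ[F] N) :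
    finrank K (LinearMap.ker (f.baseChange K)) = finrank F (LinearMap.ker f) :=
  (LinearMap.tensorKerEquiv K K f).finrank_eq.symm.trans Module.finrank_baseChange

open Module in
-- f' and the base change of f have the same matrix, hence equal rank, and rank-nullity gives equal
-- nullity.
theorem LinearMap.finrank_ker_eq_of_toMatrix_eq_map {F K M N M' N' ι κ : Type*} [Field F] [Field K]
    [Algebra F K] [AddCommGroup M] [Module F M] [AddCommGroup N] [Module F N]
    [AddCommGroup M'] [Module K M'] [AddCommGroup N'] [Module K N']
    [Fintype ι] [DecidableEq ι] [Fintype κ] [DecidableEq κ]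
    (b : Basis ι F M) (c : Basis κ F N) (b' : Basis ι K M') (c' : Basis κ K N')
    (f : M →ₗ[F] N) (f' : M' →ₗ[K] N')
    (h : LinearMap.toMatrix b' c' f' = (LinearMap.toMatrix b c f).map (algebraMap F K)) :
    finrank K (LinearMap.ker f') = finrank F (LinearMap.ker f) := by
  rw [← LinearMap.finrank_ker_baseChange K f]
  have := Module.Finite.of_basis b'
  have := Module.Finite.of_basis c'
  have := Module.Finite.of_basis b
  have h1 := LinearMap.finrank_range_add_finrank_ker f'
  have h2 := LinearMap.finrank_range_add_finrank_ker (f.baseChange K)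
  rw [← LinearMap.toMatrix_baseChange] at h
  have h3 := Matrix.rank_eq_finrank_range_toLin (LinearMap.toMatrix b' c' f') c' b'
  have h4 := Matrix.rank_eq_finrank_range_toLin
    (LinearMap.toMatrix (Algebra.TensorProduct.basis K b) (Algebra.TensorProduct.basis K c) (f.baseChange K))
    (Algebra.TensorProduct.basis K c) (Algebra.TensorProduct.basis K b)
  rw [Matrix.toLin_toMatrix] at h3 h4
  rw [finrank_eq_card_basis b'] at h1
  rw [finrank_eq_card_basis (Algebra.TensorProduct.basis K b)] at h2
  rw [h] at h3
  omega

/-- The map `X ↦ A X - X B` on matrices. -/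
def sylvesterMap {F : Type*} [Field F] {r s : ℕ}
    (A : Matrix (Fin r) (Fin r) F) (B : Matrix (Fin s) (Fin s) F) :
    Matrix (Fin r) (Fin s) F →ₗ[F] Matrix (Fin r) (Fin s) F where
  toFun X := A * X - X * B
  map_add' X Y := by rw [Matrix.mul_add, Matrix.add_mul]; abel
  map_smul' c X := by simp [smul_sub]

namespace intertwiningCode

open Module

variable {F : Type*} [Field F] {r s : ℕ} (A : Matrix (Fin r) (Fin r) F)
  (B : Matrix (Fin s) (Fin s) F)

theorem eq_ker_sylvesterMap : intertwiningCode A B = LinearMap.ker (sylvesterMap A B) := by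
  ext X
  exact sub_eq_zero.symm

/-- In the basis of matrix units, the Sylvester map over K has the matrix of the one over F. -/
theorem finrank_map (K : Type*) [Field K] [Algebra F K] :
    finrank K (intertwiningCode (A.map (algebraMap F K)) (B.map (algebraMap F K))) =
      finrank F (intertwiningCode A B) := by
  rw [eq_ker_sylvesterMap, eq_ker_sylvesterMap]
  refine LinearMap.finrank_ker_eq_of_toMatrix_eq_map (Matrix.stdBasis F _ _)
    (Matrix.stdBasis F _ _) (Matrix.stdBasis K _ _) (Matrix.stdBasis K _ _) _ _ ?_
  ext ⟨k, l⟩ ⟨i, j⟩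
  have hsingle : (Matrix.single i j (1 : K)) =
      (Matrix.single i j (1 : F)).map (algebraMap F K) := by simp
  rw [Matrix.map_apply, LinearMap.toMatrix_apply, LinearMap.toMatrix_apply,
    Matrix.stdBasis_eq_single, Matrix.stdBasis_eq_single]
  change (A.map (algebraMap F K) * Matrix.single i j (1 : K) -
    Matrix.single i j (1 : K) * B.map (algebraMap F K)) k l =
    algebraMap F K ((A * Matrix.single i j (1 : F) - Matrix.single i j (1 : F) * B) k l)
  rw [hsingle, ← Matrix.map_mul, ← Matrix.map_mul, Matrix.sub_apply, Matrix.sub_apply, map_sub]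
  rfl

theorem finrank_eq_intertwiners :
    finrank F (intertwiningCode A B) =
      finrank F (intertwiners (Matrix.toLin' A) (Matrix.toLin' B)) := by
  rw [← LinearEquiv.finrank_map_eq (Matrix.toLin' (R := F) (m := Fin r) (n := Fin s))]
  suffices h : (intertwiningCode A B).map (Matrix.toLin' : _ ≃ₗ[F] _).toLinearMap =
      intertwiners (Matrix.toLin' A) (Matrix.toLin' B) by rw [h]
  ext X
  obtain ⟨X, rfl⟩ := Matrix.toLin'.surjective X
  have h : Matrix.toLin' X ∈ intertwiners (Matrix.toLin' A) (Matrix.toLin' B) ↔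
      A * X = X * B := by
    rw [← Matrix.toLin'.injective.eq_iff, Matrix.toLin'_mul, Matrix.toLin'_mul,
      intertwiners.mem_iff, LinearMap.ext_iff]
    rfl
  rw [h]
  constructor
  · rintro ⟨Y, hY, hXY⟩
    rwa [← Matrix.toLin'.injective hXY]
  · exact fun hX ↦ ⟨X, hX, rfl⟩

theorem finrank_eq_intertwiners_closureEnd :
    finrank F (intertwiningCode A B) =
      finrank (AlgebraicClosure F) (intertwiners (closureEnd A) (closureEnd B)) := by
  rw [← finrank_map A B (AlgebraicClosure F), finrank_eq_intertwiners]
  rfl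

end intertwiningCode

namespace Matrix

variable {F : Type*} [Field F] {r : ℕ} (A : Matrix (Fin r) (Fin r) F)

theorem finrank_ker_toLin'_eq_sub_rank :
    Module.finrank F (LinearMap.ker (toLin' A)) = r - A.rank := by
  have h := LinearMap.finrank_range_add_finrank_ker (toLin' A)
  rw [Module.finrank_fin_fun] at h
  have h' : A.rank = Module.finrank F (LinearMap.range (toLin' A)) := rfl
  omega

theorem genEigDim_eq_zero_iff (α : AlgebraicClosure F) :
    genEigDim A α = 0 ↔ (closureEnd A).maxGenEigenspace α = ⊥ :=
  Submodule.finrank_eq_zero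

theorem finite_genEigDim_ne_zero : {α : AlgebraicClosure F | genEigDim A α ≠ 0}.Finite := by
  simpa only [ne_eq, genEigDim_eq_zero_iff] using (closureEnd A).finite_maxGenEigenspace_ne_bot

theorem eigDim_le_genEigDim (α : AlgebraicClosure F) : eigDim A α ≤ genEigDim A α :=
  Submodule.finrank_mono ((closureEnd A).genEigenspace α |>.monotone le_top)

end Matrix

/-- The first two conjuncts say that the sums over the algebraic closure are finite sums (so that
`∑ᶠ` is the honest sum). The differences are of natural numbers; the rank of an `r × r` matrix is
at most `r`, so no truncation occurs. -/
theorem theorem5p1 {F : Type*} [Field F] (r s : ℕ)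
    (A : Matrix (Fin r) (Fin r) F) (B : Matrix (Fin s) (Fin s) F) :
    {α : AlgebraicClosure F | eigDim A α * eigDim B α ≠ 0}.Finite ∧
    {α : AlgebraicClosure F | genEigDim A α * genEigDim B α ≠ 0}.Finite ∧
    (∑ᶠ α : AlgebraicClosure F, eigDim A α * eigDim B α
        ≤ Module.finrank F (intertwiningCode A B) ∧
      Module.finrank F (intertwiningCode A B)
        ≤ ∑ᶠ α : AlgebraicClosure F, genEigDim A α * genEigDim B α) ∧
    ((r - A.rank) * (s - B.rank) ≤ Module.finrank F (intertwiningCode A B) ∧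
      Module.finrank F (intertwiningCode A B)
        ≤ (r - A.rank) * (s - B.rank) + A.rank * B.rank) := by
  -- The eigenvalues of B serve as a common finite index set: they support both sums, and their
  -- generalized eigenspaces span the domain.
  have hB := B.finite_genEigDim_ne_zero
  have hgen : {α | genEigDim A α * genEigDim B α ≠ 0} ⊆ {α | genEigDim B α ≠ 0} :=
    fun α h ↦ right_ne_zero_of_mul h
  have heig : {α | eigDim A α * eigDim B α ≠ 0} ⊆ {α | genEigDim B α ≠ 0} := fun α h ↦
    (Nat.pos_of_ne_zero (right_ne_zero_of_mul h) |>.trans_le (B.eigDim_le_genEigDim α)).ne'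
  refine ⟨hB.subset heig, hB.subset hgen, ⟨?_, ?_⟩, ?_, ?_⟩
  · rw [finsum_eq_sum_of_support_subset (s := hB.toFinset) _ (fun α h ↦ hB.mem_toFinset.2 (heig h)),
      intertwiningCode.finrank_eq_intertwiners_closureEnd]
    exact intertwiners.sum_finrank_eigenspace_mul_le _ _ _
  · rw [finsum_eq_sum_of_support_subset (s := hB.toFinset) _ (fun α h ↦ hB.mem_toFinset.2 (hgen h)),
      intertwiningCode.finrank_eq_intertwiners_closureEnd]
    refine intertwiners.finrank_le_sum_maxGenEigenspace _ _ _ ?_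
    rw [eq_top_iff, ← Module.End.iSup_maxGenEigenspace_eq_top (closureEnd B)]
    refine iSup_le fun α ↦ ?_
    by_cases hα : genEigDim B α = 0
    · rw [(B.genEigDim_eq_zero_iff α).1 hα]
      exact bot_le
    · exact le_iSup₂_of_le α (hB.mem_toFinset.2 hα) le_rfl
  · rw [intertwiningCode.finrank_eq_intertwiners, ← A.finrank_ker_toLin'_eq_sub_rank,
      ← B.finrank_ker_toLin'_eq_sub_rank]
    exact intertwiners.finrank_ker_mul_le _ _
  · rw [intertwiningCode.finrank_eq_intertwiners, ← A.finrank_ker_toLin'_eq_sub_rank,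
      ← B.finrank_ker_toLin'_eq_sub_rank]
    exact intertwiners.finrank_le_ker_add_range _ _
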